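/- A \emph{universe} is a lattice $(\vec U,\le,\vee,\wedge)$ with an order-reversing involution $\vec s\mapsto \vec s^{\,*}$; a \emph{separation system} in it is a subset $\vec S\subseteq\vec U$ closed under $^*$. For $\vec s\in\vec U$ let $s=\{\vec s,\vec s^{\,*}\}$, and let $S=\{s:\vec s\in\vec S\}$. An element $\vec s\in\vec S$ is \emph{trivial} in $\vec S$ if there is $\vec r\in\vec S$ with $r\ne s$, $\vec s\le\vec r$ and $\vec s\le\vec r^{\,*}$; its inverse is then \emph{cotrivial}. A \emph{star} in $\vec S$ is a (possibly empty) set $\sigma\subseteq\vec S$ such that $\vec s\le\vec t^{\,*}$ for all distinct $\vec s,\vec t\in\sigma$. A set $\mathcal F\subseteq 2^{\vec S}$ of stars is \emph{standard for $S$} if $\{\vec s\}\in\mathcal F$ for every cotrivial $\vec s\in\vec S$. An \emph{orientation} of $S$ is a set $O\subseteq\vec S$ containing exactly one element of $s$ for every $s\in S$. It is \emph{consistent} if there are no $\vec r,\vec s\in O$ with $r\neq s$ and $\vec r^{\,*}\le\vec s$. An \emph{$\mathcal F$-tangle} of $S$ is a consistent orientation of $S$ that has no element of $\mathcal F$ as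 a subset. An \emph{$S$-tree} is a pair $(T,\alpha)$ of a finite (nonempty) tree $T$ and a map $\alpha$ from the set of oriented edges of $T$ to $\vec S$ with $\alpha(y,x)=\alpha(x,y)^*$ for every oriented edge $(x,y)$. It is \emph{over $\mathcal F$} if $\{\alpha(x,t): x \text{ a neighbour of } t\}\in\mathcal F$ for every node $t$ of $T$. Let $\vec r,\vec s\in\vec S$. We say that $\vec s$ \emph{emulates $\vec r$ in $\vec S$ for $\mathcal F$} if $\vec s\ge\vec r$; $\vec s\vee\vec t\in\vec S$ for every $\vec t\in\vec S\setminus\{\vec r^{\,*}\}$ with $\vec t\ge\vec r$; and, for every $\sigma\in\mathcal F$ with $\vec r^{\,*}\notin\sigma$ and every $\vec x\in\sigma$ with $\vec x\ge\vec r$, the set $\{\vec x\vee\vec s\}\cup\{\vec y\wedge\vec s^{\,*}:\vec y\in\sigma\setminus\{\vec x\}\}$ lies in $\mathcal F$. An element $\vec r\in\vec S$ is \emph{$\mathcal F$-critical} if $\vec r\in\sigma$ for some $\sigma\in\mathcal F$, but there is no $\sigma'\in\mathcal F$ with $\sigma'\cap\{\vec r,\vec r^{\,*}\}=\{\vec r^{\,*}\}$.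 The system $S$ is \emph{critically $\mathcal F$-separable} if for all $\vec r,\vec r'\in\vec S$ with $\vec r\le\vec r'$ such that $\vec r$ and $\vec r'^{\,*}$ are $\mathcal F$-critical, there is $\vec s_0\in\vec S$ such that $\vec s_0$ emulates $\vec r$ in $\vec S$ for $\mathcal F$ and $\vec s_0^{\,*}$ emulates $\vec r'^{\,*}$ in $\vec S$ for $\mathcal F$. \textbf{Theorem.} Let $U$ be a finite universe, $S\subseteq U$ a separation system, and $\mathcal F\subseteq 2^{\vec S}$ a set of stars such that $\mathcal F$ is standard for $S$ and $S$ is critically $\mathcal F$-separable. Then precisely one of the following holds: (i) there is an $S$-tree over $\mathcal F$; (ii) there is an $\mathcal F$-tangle of $S$. -/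

import Mathlib

namespace TangleTree

/-- A universe of separations: a lattice of oriented separations together with an
order-reversing involution, written `s⁻¹` for the inverse of `s`. -/
class SepUniverse (U : Type*) extends Lattice U, InvolutiveInv U where
  /-- The involution reverses the order. -/
  inv_antitone : ∀ r s : U, r ≤ s → s⁻¹ ≤ r⁻¹

section
variable {U : Type*} [SepUniverse U]

/-- De Morgan's law, a consequence of the axioms. -/
theorem inv_sup_eq (s t : U) : (s ⊔ t)⁻¹ = s⁻¹ ⊓ t⁻¹ := by
  refine le_antisymm (le_inf (SepUniverse.inv_antitone _ _ le_sup_left)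
    (SepUniverse.inv_antitone _ _ le_sup_right)) ?_
  have h : s ⊔ t ≤ (s⁻¹ ⊓ t⁻¹)⁻¹ := by
    refine sup_le ?_ ?_
    · simpa using SepUniverse.inv_antitone _ _ (inf_le_left : s⁻¹ ⊓ t⁻¹ ≤ s⁻¹)
    · simpa using SepUniverse.inv_antitone _ _ (inf_le_right : s⁻¹ ⊓ t⁻¹ ≤ t⁻¹)
  simpa using SepUniverse.inv_antitone _ _ h

/-- The underlying unoriented separation of an oriented separation: the set of its
orientations. -/
def sep (s : U) : Set U := {s, s⁻¹}

/-- A separation system inside the universe, given as its set of oriented separations. -/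
def IsSepSystem (S : Set U) : Prop := ∀ s ∈ S, s⁻¹ ∈ S

/-- `s` is trivial in `S`: some other separation `r` of `S` has both orientations above `s`. -/
def IsTrivialIn (S : Set U) (s : U) : Prop :=
  s ∈ S ∧ ∃ r ∈ S, sep r ≠ sep s ∧ s ≤ r ∧ s ≤ r⁻¹

/-- `s` is cotrivial in `S`: its inverse is trivial in `S`. -/
def IsCotrivialIn (S : Set U) (s : U) : Prop := IsTrivialIn S s⁻¹

/-- A star in `S`: a set of separations in `S` whose distinct elements point towards each other.
The empty set is a star. -/
def IsStar (S : Set U) (σ : Set U) : Prop :=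
  σ ⊆ S ∧ ∀ s ∈ σ, ∀ t ∈ σ, s ≠ t → s ≤ t⁻¹

/-- `F` is standard for `S`: it contains `{s}` for every cotrivial `s`. -/
def IsStandard (S : Set U) (F : Set (Set U)) : Prop :=
  ∀ s ∈ S, IsCotrivialIn S s → {s} ∈ F

/-- An orientation of `S`: a set containing exactly one orientation of each separation of `S`. -/
structure IsOrientation (S O : Set U) : Prop where
  subset : O ⊆ S
  antisymmetric : ∀ s ∈ S, (O ∩ sep s).Subsingleton
  orients : ∀ s ∈ S, s ∈ O ∨ s⁻¹ ∈ O

/-- Consistency: no two elements with distinct underlying separations point away from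
each other. -/
def IsConsistent (O : Set U) : Prop :=
  ∀ r ∈ O, ∀ s ∈ O, ¬ (r⁻¹ ≤ s ∧ sep r ≠ sep s)

/-- An `F`-tangle of `S`: a consistent orientation of `S` that includes no set in `F`. -/
structure IsTangle (S : Set U) (F : Set (Set U)) (O : Set U) : Prop where
  isOrientation : IsOrientation S O
  isConsistent : IsConsistent O
  avoids : ∀ σ ∈ F, ¬ σ ⊆ O

/-- The shift of the star `σ`, with distinguished element `x`, to `s₀`. -/
def shift (σ : Set U) (x s₀ : U) : Set U :=
  insert (x ⊔ s₀) ((fun y => y ⊓ s₀⁻¹) '' (σ \ {x}))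

/-- `s` emulates `r` in `S`. -/
def Emulates (S : Set U) (s r : U) : Prop :=
  r ≤ s ∧ ∀ t ∈ S, t ≠ r⁻¹ → r ≤ t → s ⊔ t ∈ S

/-- `s` emulates `r` in `S` for `F`. -/
def EmulatesFor (S : Set U) (F : Set (Set U)) (s r : U) : Prop :=
  Emulates S s r ∧ ∀ σ ∈ F, r⁻¹ ∉ σ → ∀ x ∈ σ, r ≤ x → shift σ x s ∈ F

/-- `r` is `F`-critical: it lies in a star of `F`, but no star of `F` meets `{r, r⁻¹}` in
exactly `{r⁻¹}`. -/
def IsCritical (F : Set (Set U)) (r : U) : Prop :=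
  (∃ σ ∈ F, r ∈ σ) ∧ ¬ ∃ σ ∈ F, σ ∩ sep r = {r⁻¹}

/-- `S` is critically `F`-separable. -/
def IsCriticallySeparable (S : Set U) (F : Set (Set U)) : Prop :=
  ∀ r ∈ S, ∀ r' ∈ S, IsCritical F r → IsCritical F r'⁻¹ → r ≤ r' →
    ∃ s₀ ∈ S, EmulatesFor S F s₀ r ∧ EmulatesFor S F s₀⁻¹ r'⁻¹

/-- An `S`-tree with node set `V`: a tree together with a labelling of its oriented edges by
elements of `S` that commutes with the inversions. -/
structure STree (S : Set U) (V : Type*) where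
  /-- The underlying tree. -/
  graph : SimpleGraph V
  isTree : graph.IsTree
  /-- The labels of the oriented edges. -/
  label : graph.Dart → U
  label_mem : ∀ e, label e ∈ S
  label_symm : ∀ e, label e.symm = (label e)⁻¹

/-- The set of labels of the oriented edges pointing towards the node `t`. -/
def STree.nodeLabels {S : Set U} {V : Type*} (T : STree S V) (t : V) : Set U :=
  T.label '' {e | e.snd = t}

/-- The `S`-tree is over `F`. -/
def STree.IsOver {S : Set U} {V : Type*} (T : STree S V) (F : Set (Set U)) : Prop :=
  ∀ t, T.nodeLabels t ∈ F

/-- There is a (finite) `S`-tree over `F`. -/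
def ExistsSTreeOver (S : Set U) (F : Set (Set U)) : Prop :=
  ∃ (V : Type) (_ : Finite V) (T : STree S V), T.IsOver F

end

end TangleTree

namespace TangleTree

/-! ### Deriving separations with the stars of `F` as rules. -/

section Derivations
variable {U : Type*} [SepUniverse U]

/-! Read a star `σ ∈ F` containing `x⁻¹` as an inference rule: a tangle that contains the rest of
`σ` must contain `x`. A refutation from the empty set unfolds to an S-tree over `F`, so it suffices
to refute `∅` when there is no tangle.

More generally every partial orientation `P` is refuted, by induction on its complement. If `P`
orients all of `S`, it is a consistent orientation, hence includes a star of `F`. Otherwise some `s`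
is unoriented; choose minimal unoriented `r ≤ s` and `q ≤ s⁻¹`. Adding either to `P` gives a
refutation by induction. If `P` itself had none, a deduction theorem (`Refutes.derives_inv`) would
derive `r⁻¹` and `q⁻¹` from `P`, and minimality would make `r` and `q` critical. As `r ≤ q⁻¹`,
separability yields `s₀`, and `Derives.shift` turns the two derivations into derivations of `s₀⁻¹`
and `s₀`. Joined along this edge they refute `P`, a contradiction.

That tree and tangle exclude each other is a count of nodes against edges. -/

theorem inv_le_inv_of_le {r s : U} (h : r ≤ s) : s⁻¹ ≤ r⁻¹ := SepUniverse.inv_antitone _ _ h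

theorem le_inv_of_le_inv {r s : U} (h : r ≤ s⁻¹) : s ≤ r⁻¹ := by
  simpa using inv_le_inv_of_le h

theorem inv_le_of_inv_le {r s : U} (h : r⁻¹ ≤ s) : s⁻¹ ≤ r := by
  simpa using inv_le_inv_of_le h

theorem inv_inf_eq (s t : U) : (s ⊓ t)⁻¹ = s⁻¹ ⊔ t⁻¹ := by
  have h := inv_sup_eq s⁻¹ t⁻¹
  rw [inv_inv, inv_inv] at h
  rw [← h, inv_inv]

theorem sep_eq_iff {r s : U} : sep r = sep s ↔ r = s ∨ r = s⁻¹ := by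
  constructor
  · intro h
    have : r ∈ sep s := h ▸ Or.inl rfl
    exact this
  · rintro (rfl | rfl)
    · rfl
    · simp [sep, Set.pair_comm]

/-- A separation that is not trivial and lies below both orientations of `y` is an orientation
of `y`. -/
theorem eq_or_eq_inv_of_not_isTrivialIn {S : Set U} {r y : U} (hr : r ∈ S)
    (hnt : ¬ IsTrivialIn S r) (hy : y ∈ S) (h1 : r ≤ y) (h2 : r ≤ y⁻¹) :
    y = r ∨ y = r⁻¹ := by
  by_contra h
  exact hnt ⟨hr, y, hy, fun e => h (sep_eq_iff.1 e), h1, h2⟩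

/-- `Derives F P x`: there is a rooted tree whose nodes are labelled by stars in `F`, whose leaves
are labelled by elements of `P`, and whose root edge is labelled by `x`, pointing out of the
tree. -/
inductive Derives (F : Set (Set U)) (P : Set U) : U → Prop
  | leaf {x : U} : x ∈ P → Derives F P x
  | node {x : U} (σ : Set U) : σ ∈ F → x⁻¹ ∈ σ → (∀ y ∈ σ, y ≠ x⁻¹ → Derives F P y) →
      Derives F P x

/-- Some star in `F` consists of separations derived from `P`. -/
def Refutes (F : Set (Set U)) (P : Set U) : Prop := ∃ σ ∈ F, ∀ y ∈ σ, Derives F P y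

theorem Derives.trans {F : Set (Set U)} {P Q : Set U} (h : ∀ x ∈ P, Derives F Q x) {x : U}
    (hx : Derives F P x) : Derives F Q x := by
  induction hx with
  | leaf hp => exact h _ hp
  | node σ hσ hxσ _ ih => exact .node σ hσ hxσ ih

theorem Derives.of_insert_of_derives {F : Set (Set U)} {P : Set U} {r x : U} (hr : Derives F P r)
    (hx : Derives F (insert r P) x) : Derives F P x := by
  refine hx.trans ?_
  rintro y (rfl | hy)
  exacts [hr, .leaf hy]

theorem Refutes.of_insert_of_notMem {F : Set (Set U)} {P : Set U} {r : U}
    (hr : ∀ σ ∈ F, r ∉ σ) (h : Refutes F (insert r P)) : Refutes F P := by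
  have key : ∀ {x}, Derives F (insert r P) x → x = r ∨ Derives F P x := by
    intro x hx
    induction hx with
    | leaf hp => exact hp.imp id .leaf
    | node σ hσ hxσ _ ih =>
      refine Or.inr (.node σ hσ hxσ fun y hy hne => (ih y hy hne).resolve_left ?_)
      rintro rfl
      exact hr σ hσ hy
  obtain ⟨σ, hσ, hd⟩ := h
  refine ⟨σ, hσ, fun y hy => (key (hd y hy)).resolve_left ?_⟩
  rintro rfl
  exact hr σ hσ hy

/-- Separations derived from `r` along a single path, modulo separations derived from `P`. -/
inductive DerivesAlong (F : Set (Set U)) (P : Set U) (r : U) : U → Prop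
  | base : DerivesAlong F P r r
  | step {y x : U} (σ : Set U) : DerivesAlong F P r y → σ ∈ F → y ∈ σ → x⁻¹ ∈ σ → y ≠ x⁻¹ →
      (∀ z ∈ σ, z ≠ y → z ≠ x⁻¹ → Derives F P z) → DerivesAlong F P r x

/-- A path of rules can be reversed: in each star, the roles of the premise on the path and of the
conclusion are exchanged, up to inversion. -/
theorem DerivesAlong.derives_inv {F : Set (Set U)} {P : Set U} {r x : U}
    (h : DerivesAlong F P r x) (hx : Derives F P x⁻¹) : Derives F P r⁻¹ := by
  induction h with
  | base => exact hx
  | @step y x σ _ hσ hy hxσ _ hrest ih =>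
    refine ih (.node σ hσ (by simpa using hy) fun z hz hne => ?_)
    rw [inv_inv] at hne
    by_cases hzx : z = x⁻¹
    · exact hzx ▸ hx
    · exact hrest z hz hne hzx

variable {S : Set U} {F : Set (Set U)} {P : Set U} {r : U}

theorem DerivesAlong.le_and_ne (hS : IsSepSystem S) (hstar : ∀ σ ∈ F, IsStar S σ) (hr : r ∈ S)
    (hnt : ¬ IsTrivialIn S r) (hnd : r ≠ r⁻¹) {x : U} (h : DerivesAlong F P r x) :
    x ∈ S ∧ r ≤ x ∧ x ≠ r⁻¹ := by
  induction h with
  | base => exact ⟨hr, le_rfl, hnd⟩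
  | @step y x σ _ hσ hy hxσ hne _ ih =>
    obtain ⟨hyS, hry, hyr⟩ := ih
    have hyx : y ≤ x := by simpa using (hstar σ hσ).2 y hy _ hxσ hne
    refine ⟨by simpa using hS _ ((hstar σ hσ).1 hxσ), hry.trans hyx, ?_⟩
    rintro rfl
    rcases eq_or_eq_inv_of_not_isTrivialIn hr hnt hyS hry (le_inv_of_le_inv hyx) with e | e
    · exact hne (by rw [inv_inv, e])
    · exact hyr e

/-- Two distinct such elements of a star would each have both orientations above `r`; as `r` is
nontrivial, both would equal `r`. So dependence on `r` never branches, which is what makes it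
reversible. -/
theorem DerivesAlong.eq_of_mem_star (hS : IsSepSystem S) (hstar : ∀ σ ∈ F, IsStar S σ)
    (hr : r ∈ S) (hnt : ¬ IsTrivialIn S r) (hnd : r ≠ r⁻¹) {σ : Set U} (hσ : σ ∈ F) {y z : U}
    (hy : y ∈ σ) (hz : z ∈ σ) (hNy : DerivesAlong F P r y) (hNz : DerivesAlong F P r z) :
    y = z := by
  by_contra hne
  obtain ⟨hyS, hry, hyr⟩ := hNy.le_and_ne hS hstar hr hnt hnd
  obtain ⟨hzS, hrz, hzr⟩ := hNz.le_and_ne hS hstar hr hnt hnd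
  have h1 := (hstar σ hσ).2 y hy z hz hne
  have h2 := (hstar σ hσ).2 z hz y hy (Ne.symm hne)
  have e1 := (eq_or_eq_inv_of_not_isTrivialIn hr hnt hyS hry (hrz.trans h2)).resolve_right hyr
  have e2 := (eq_or_eq_inv_of_not_isTrivialIn hr hnt hzS hrz (hry.trans h1)).resolve_right hzr
  exact hne (e1.trans e2.symm)

/-- A deduction theorem: if adding `r` to `P` leads to a refutation, then the inverse of `r` can be
derived from `P`. -/
theorem Refutes.derives_inv (hS : IsSepSystem S) (hstar : ∀ σ ∈ F, IsStar S σ)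
    (hr : r ∈ S) (hnt : ¬ IsTrivialIn S r) (hnd : r ≠ r⁻¹) (hP : ¬ Refutes F P)
    (h : Refutes F (insert r P)) : Derives F P r⁻¹ := by
  have key : ∀ {x}, Derives F (insert r P) x → Derives F P x ∨ DerivesAlong F P r x := by
    intro x hx
    induction hx with
    | leaf hp =>
      rcases hp with rfl | hp
      exacts [Or.inr .base, Or.inl (.leaf hp)]
    | @node x σ hσ hxσ _ ih =>
      by_cases hall : ∀ y ∈ σ, y ≠ x⁻¹ → Derives F P y
      · exact Or.inl (.node σ hσ hxσ hall)
      · push Not at hall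
        obtain ⟨y, hy, hne, hyn⟩ := hall
        have hNy := (ih y hy hne).resolve_left hyn
        refine Or.inr (.step σ hNy hσ hy hxσ hne fun z hz hzy hzx => ?_)
        exact (ih z hz hzx).resolve_right fun hNz =>
          hzy (hNz.eq_of_mem_star hS hstar hr hnt hnd hσ hz hy hNy)
  obtain ⟨σ, hσ, hd⟩ := h
  by_cases hall : ∀ y ∈ σ, Derives F P y
  · exact absurd ⟨σ, hσ, hall⟩ hP
  · push Not at hall
    obtain ⟨y, hy, hyn⟩ := hall
    have hNy := (key (hd y hy)).resolve_left hyn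
    refine hNy.derives_inv (.node σ hσ (by simpa using hy) fun z hz hne => ?_)
    rw [inv_inv] at hne
    exact (key (hd z hz)).resolve_right fun hNz =>
      hne (hNz.eq_of_mem_star hS hstar hr hnt hnd hσ hz hy hNy)

/-- Derivations of the inverse of `r` can be shifted to separations emulating `r`. -/
theorem Derives.shift (hS : IsSepSystem S) (hstar : ∀ σ ∈ F, IsStar S σ) (hPS : P ⊆ S)
    (hdown : ∀ p ∈ P, ∀ q ∈ S, q ≤ p → q ∈ P) (hr : ¬ Derives F P r) {s : U}
    (hs : EmulatesFor S F s r) (h : Derives F P r⁻¹) : Derives F P s⁻¹ := by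
  have key : ∀ {x}, Derives F P x → x ≤ r⁻¹ → Derives F P (x ⊓ s⁻¹) := by
    intro x hx
    induction hx with
    | @leaf x hp =>
      intro hxr
      have hmem : s ⊔ x⁻¹ ∈ S := by
        refine hs.1.2 _ (hS _ (hPS hp)) (fun e => hr ?_) (le_inv_of_le_inv hxr)
        rw [inv_inj] at e
        exact .leaf (e ▸ hp)
      have hmem' := hS _ hmem
      rw [inv_sup_eq, inv_inv, inf_comm] at hmem'
      exact .leaf (hdown x hp _ hmem' inf_le_left)
    | @node x σ hσ hxσ hd ih =>
      intro hxr
      by_cases hrσ : r⁻¹ ∈ σ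
      · by_cases e : r⁻¹ = x⁻¹
        · rw [inv_inj] at e
          exact absurd (e ▸ Derives.node σ hσ hxσ hd) hr
        · have hrx : r⁻¹ ≤ x := by simpa using (hstar σ hσ).2 _ hrσ _ hxσ e
          obtain rfl := le_antisymm hxr hrx
          exact ih _ hrσ e le_rfl
      · refine .node _ (hs.2 σ hσ hrσ _ hxσ (le_inv_of_le_inv hxr)) ?_ ?_
        · rw [inv_inf_eq, inv_inv]
          exact Set.mem_insert _ _
        · rintro y (rfl | ⟨z, ⟨hz, hzx⟩, rfl⟩) hne
          · exact absurd (by rw [inv_inf_eq, inv_inv]) hne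
          · have hzx' : z ≠ x⁻¹ := hzx
            refine ih z hz hzx' (le_trans ?_ hxr)
            simpa using (hstar σ hσ).2 z hz _ hxσ hzx'
  have := key h le_rfl
  rwa [inf_eq_right.2 (inv_le_inv_of_le hs.1.1)] at this

/-! ### Partial orientations and the main induction. -/

/-- A down-closed partial orientation of `S` without cotrivial elements. -/
structure IsPartialOrientation (S P : Set U) : Prop where
  subset : P ⊆ S
  down : ∀ p ∈ P, ∀ q ∈ S, q ≤ p → q ∈ P
  antisymm : ∀ p ∈ P, p⁻¹ ∈ P → p = p⁻¹
  not_cotrivial : ∀ p ∈ P, ¬ IsCotrivialIn S p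

/-- `r` is minimal among the separations in `S` that are not oriented by `P`. -/
structure IsMinUnoriented (S P : Set U) (r : U) : Prop where
  mem : r ∈ S
  notMem : r ∉ P
  inv_notMem : r⁻¹ ∉ P
  of_lt : ∀ q ∈ S, q < r → q ∈ P

theorem exists_isMinUnoriented_le [Finite U] (hP : IsPartialOrientation S P)
    (hS : IsSepSystem S) {s : U} (hs : s ∈ S) (h1 : s ∉ P) (h2 : s⁻¹ ∉ P) :
    ∃ r ≤ s, IsMinUnoriented S P r := by
  obtain ⟨r, hrs, hmin⟩ := (Set.toFinite {q : U | q ∈ S ∧ q ∉ P ∧ q⁻¹ ∉ P}).exists_le_minimal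
    (a := s) ⟨hs, h1, h2⟩
  obtain ⟨hrS, hr1, hr2⟩ := hmin.prop
  refine ⟨r, hrs, hrS, hr1, hr2, fun q hq hlt => ?_⟩
  by_contra hqP
  by_cases hqP' : q⁻¹ ∈ P
  · exact hr2 (hP.down _ hqP' _ (hS _ hrS) (inv_le_inv_of_le hlt.le))
  · exact hlt.not_ge (hmin.le_of_le ⟨hq, hqP, hqP'⟩ hlt.le)

theorem IsPartialOrientation.insert (hS : IsSepSystem S) (hP : IsPartialOrientation S P)
    (hr : IsMinUnoriented S P r) : IsPartialOrientation S (insert r P) where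
  subset := Set.insert_subset hr.mem hP.subset
  down := by
    rintro p (rfl | hp) q hq hqp
    · rcases hqp.eq_or_lt with e | hlt
      · exact Or.inl e
      · exact Or.inr (hr.of_lt q hq hlt)
    · exact Or.inr (hP.down p hp q hq hqp)
  antisymm := by
    rintro p (rfl | hp) (h | h)
    · exact h.symm
    · exact absurd h hr.inv_notMem
    · exact absurd (by rwa [← h, inv_inv]) hr.inv_notMem
    · exact hP.antisymm p hp h
  not_cotrivial := by
    rintro p (rfl | hp)
    · rintro ⟨-, t, ht, hne, h1, h2⟩
      have htp : t ≠ p := fun e => hne (sep_eq_iff.2 (Or.inr (by rw [inv_inv, e])))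
      have htP := hr.of_lt t ht (lt_of_le_of_ne (by simpa using inv_le_of_inv_le h2) htp)
      exact hr.inv_notMem (hP.down t htP _ (hS _ hr.mem) h1)
    · exact hP.not_cotrivial p hp

/-- A partial orientation that orients all of `S` is a consistent orientation. -/
theorem IsPartialOrientation.isOrientation (hP : IsPartialOrientation S P)
    (h : ∀ s ∈ S, s ∈ P ∨ s⁻¹ ∈ P) : IsOrientation S P where
  subset := hP.subset
  antisymmetric := by
    rintro s - x ⟨hx, hxs⟩ y ⟨hy, hys⟩
    rcases hxs with rfl | rfl <;> rcases hys with rfl | rfl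
    · rfl
    · exact hP.antisymm _ hx hy
    · exact (hP.antisymm _ hy hx).symm
    · rfl
  orients := h

theorem IsPartialOrientation.isConsistent (hS : IsSepSystem S) (hP : IsPartialOrientation S P) :
    IsConsistent P := by
  rintro r hr s hs ⟨hle, hne⟩
  -- Down-closure forces `r = r⁻¹`, and such a degenerate `r` would witness that `s` is cotrivial.
  have hr' : r⁻¹ ∈ P := hP.down s hs _ (hS _ (hP.subset hr)) hle
  have e := hP.antisymm r hr hr'
  refine hP.not_cotrivial s hs ⟨hS _ (hP.subset hs), r, hP.subset hr, fun h => hne ?_,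
    inv_le_of_inv_le hle, e ▸ inv_le_of_inv_le hle⟩
  rw [h]
  exact sep_eq_iff.2 (Or.inr rfl)

/-- A minimal unoriented separation whose addition to `P` leads to a refutation is critical, unless
there is a refutation already. -/
theorem IsMinUnoriented.isCritical (hS : IsSepSystem S) (hstar : ∀ σ ∈ F, IsStar S σ)
    (hstd : IsStandard S F) (hr : IsMinUnoriented S P r) (hP : ¬ Refutes F P)
    (h : Refutes F (insert r P)) : ¬ Derives F P r ∧ IsCritical F r ∧ Derives F P r⁻¹ := by
  have hnd : ¬ Derives F P r := fun hd => by
    obtain ⟨σ, hσ, hall⟩ := h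
    exact hP ⟨σ, hσ, fun y hy => hd.of_insert_of_derives (hall y hy)⟩
  have hmem : ∃ σ ∈ F, r ∈ σ := by
    by_contra hno
    push Not at hno
    exact hP (h.of_insert_of_notMem hno)
  have hcrit : ¬ ∃ σ ∈ F, σ ∩ sep r = {r⁻¹} := by
    rintro ⟨σ, hσ, he⟩
    -- The other elements of `σ` lie strictly below `r`, hence in `P` by minimality, so `σ` derives
    -- `r` in one step.
    have hrσ : r⁻¹ ∈ σ ∩ sep r := he ▸ rfl
    refine hnd (.node σ hσ hrσ.1 fun y hy hne => .leaf (hr.of_lt y ((hstar σ hσ).1 hy) ?_))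
    refine lt_of_le_of_ne (by simpa using (hstar σ hσ).2 y hy _ hrσ.1 hne) ?_
    rintro rfl
    have : y ∈ σ ∩ sep y := ⟨hy, Or.inl rfl⟩
    rw [he] at this
    exact hne this
  refine ⟨hnd, ⟨hmem, hcrit⟩, h.derives_inv hS hstar hr.mem ?_ ?_ hP⟩
  · intro ht
    have : {r⁻¹} ∈ F := hstd _ (hS _ hr.mem) (by rwa [IsCotrivialIn, inv_inv])
    exact hnd (.node _ this rfl fun y hy hne => absurd hy hne)
  · intro e
    obtain ⟨σ, hσ, hrσ⟩ := hmem
    refine hcrit ⟨σ, hσ, ?_⟩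
    rw [sep, ← e, Set.pair_eq_singleton, Set.inter_eq_right]
    exact Set.singleton_subset_iff.2 hrσ

/-- Without tangles, every partial orientation is refuted. -/
theorem IsPartialOrientation.refutes [Finite U] (hS : IsSepSystem S)
    (hstar : ∀ σ ∈ F, IsStar S σ) (hstd : IsStandard S F) (hsep : IsCriticallySeparable S F)
    (hno : ¬ ∃ O, IsTangle S F O) (hP : IsPartialOrientation S P) : Refutes F P := by
  induction hn : (Pᶜ).ncard using Nat.strong_induction_on generalizing P with
  | _ n ih =>
  have hins : ∀ r, IsMinUnoriented S P r → Refutes F (Insert.insert r P) := by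
    intro r hr
    refine ih _ ?_ (hP.insert hS hr) rfl
    rw [← hn]
    refine Set.ncard_lt_ncard ?_
    exact compl_lt_compl_iff_lt.2 (Set.ssubset_insert hr.notMem)
  by_contra hR
  by_cases hall : ∀ s ∈ S, s ∈ P ∨ s⁻¹ ∈ P
  · refine hno ⟨P, hP.isOrientation hall, hP.isConsistent hS, fun σ hσ hsub => hR ?_⟩
    exact ⟨σ, hσ, fun y hy => .leaf (hsub hy)⟩
  push Not at hall
  obtain ⟨s, hs, h1, h2⟩ := hall
  obtain ⟨r, hrs, hr⟩ := exists_isMinUnoriented_le hP hS hs h1 h2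
  obtain ⟨q, hqs, hq⟩ := exists_isMinUnoriented_le hP hS (hS _ hs) h2 (by rwa [inv_inv])
  obtain ⟨hrd, hrc, hri⟩ := hr.isCritical hS hstar hstd hR (hins r hr)
  obtain ⟨hqd, hqc, hqi⟩ := hq.isCritical hS hstar hstd hR (hins q hq)
  obtain ⟨s₀, -, he1, he2⟩ := hsep r hr.mem q⁻¹ (hS _ hq.mem) hrc (by rwa [inv_inv])
    (hrs.trans (le_inv_of_le_inv hqs))
  rw [inv_inv] at he2
  have d1 : Derives F P s₀⁻¹ := hri.shift hS hstar hP.subset hP.down hrd he1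
  have d2 : Derives F P s₀ := by
    simpa using hqi.shift hS hstar hP.subset hP.down hqd he2
  cases d2 with
  | leaf hp => exact hr.notMem (hP.down _ hp _ hr.mem he1.1.1)
  | node σ hσ hmem hd =>
    refine hR ⟨σ, hσ, fun y hy => ?_⟩
    by_cases e : y = s₀⁻¹
    · exact e ▸ d1
    · exact hd y hy e

/-- An `S`-tree over `F` and an `F`-tangle of `S` exclude each other. -/
theorem not_isTangle_of_existsSTreeOver (hT : ExistsSTreeOver S F) {O : Set U} :
    ¬ IsTangle S F O := by
  classical
  rintro hO
  obtain ⟨V, _, T, hover⟩ := hT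
  have := Fintype.ofFinite V
  have hex : ∀ t, ∃ e : T.graph.Dart, e.snd = t ∧ T.label e ∉ O := by
    intro t
    by_contra hno
    push Not at hno
    refine hO.avoids _ (hover t) ?_
    rintro _ ⟨e, he, rfl⟩
    exact hno e he
  choose f hf hfO using hex
  -- An edge chosen from both ends would have neither orientation of its label in `O`. But a tree
  -- has fewer edges than nodes.
  have hinj : Function.Injective fun t => (⟨(f t).edge, (f t).edge_mem⟩ : T.graph.edgeSet) := by
    intro t u h
    rcases (SimpleGraph.dart_edge_eq_iff _ _).1 (congrArg Subtype.val h) with e | e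
    · rw [← hf t, ← hf u, e]
    · have h1 := hfO t
      rw [e, T.label_symm] at h1
      exact ((hO.isOrientation.orients _ (T.label_mem (f u))).elim (hfO u) h1).elim
  have h1 := Fintype.card_le_of_injective _ hinj
  have h2 := T.isTree.card_edgeFinset
  rw [SimpleGraph.edgeFinset_card, ← Nat.card_eq_fintype_card] at h2
  rw [← Nat.card_eq_fintype_card, ← Nat.card_eq_fintype_card] at h1
  rw [← Nat.card_eq_fintype_card] at h2
  exact Nat.not_succ_le_self _ (h2.le.trans h1)

end Derivations

/-! ### Trees from parent functions. -/

section ParentGraph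
variable {V : Type*} (root : V) (p : V → V)

/-- The graph joining every element other than `root` to its parent. -/
def parentGraph (d : V → ℕ) (hd : ∀ v, v ≠ root → d (p v) < d v) : SimpleGraph V where
  Adj v w := (v ≠ root ∧ p v = w) ∨ (w ≠ root ∧ p w = v)
  symm := ⟨fun _ _ h => Or.symm h⟩
  loopless := ⟨fun v h => by
    rcases h with ⟨h, e⟩ | ⟨h, e⟩ <;>
    · have := hd v h
      rw [e] at this
      exact this.false⟩

variable {root p} {d : V → ℕ} (hd : ∀ v, v ≠ root → d (p v) < d v)

theorem parent_asymm (hd : ∀ v, v ≠ root → d (p v) < d v) {v w : V} (hv : v ≠ root) (h : p v = w) : ¬ (w ≠ root ∧ p w = v) := by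
  rintro ⟨hw, e⟩
  have h1 := hd v hv
  have h2 := hd w hw
  rw [h] at h1
  rw [e] at h2
  exact h1.not_gt h2

/-- Parents lead down to the root, giving connectedness, and the edges correspond to the non-root
vertices, so there is one fewer than vertices. -/
theorem parentGraph_isTree [Finite V] : (parentGraph root p d hd).IsTree := by
  classical
  have := Fintype.ofFinite V
  have hreach : ∀ n v, d v = n → (parentGraph root p d hd).Reachable v root := by
    intro n
    induction n using Nat.strong_induction_on with
    | _ n ih =>
    intro v hv
    by_cases h : v = root
    · rw [h]
    · have hadj : (parentGraph root p d hd).Adj v (p v) := Or.inl ⟨h, rfl⟩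
      exact hadj.reachable.trans (ih _ (hv ▸ hd v h) _ rfl)
  have hconn : (parentGraph root p d hd).Connected :=
    { preconnected := fun v w => (hreach _ v rfl).trans (hreach _ w rfl).symm
      nonempty := ⟨root⟩ }
  rw [SimpleGraph.isTree_iff_connected_and_card]
  refine ⟨hconn, ?_⟩
  let f : {v : V // v ≠ root} → (parentGraph root p d hd).edgeSet :=
    fun v => ⟨s(v.1, p v.1), Or.inl ⟨v.2, rfl⟩⟩
  have hf : Function.Bijective f := by
    constructor
    · intro v w h
      have h' : s(v.1, p v.1) = s(w.1, p w.1) := congrArg Subtype.val h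
      rcases Sym2.eq_iff.1 h' with ⟨e, -⟩ | ⟨e1, e2⟩
      · exact Subtype.ext e
      · exact (parent_asymm hd v.2 e2 ⟨w.2, e1.symm⟩).elim
    · rintro ⟨e, he⟩
      induction e using Sym2.ind with
      | _ v w =>
      rcases he with ⟨h, e⟩ | ⟨h, e⟩
      · exact ⟨⟨v, h⟩, Subtype.ext (by simp [f, e])⟩
      · exact ⟨⟨w, h⟩, Subtype.ext (by simp [f, e, Sym2.eq_swap])⟩
  rw [← Nat.card_congr (Equiv.ofBijective f hf), Nat.card_eq_fintype_card,
    Nat.card_eq_fintype_card, Fintype.card_subtype_compl, Fintype.card_subtype_eq]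
  have : 0 < Fintype.card V := Fintype.card_pos_iff.2 ⟨root⟩
  omega

end ParentGraph

/-! ### From refutations to S-trees. -/

section Trees
variable {U : Type*} [SepUniverse U] {S : Set U} {F : Set (Set U)}

/-- An `S`-tree over `F` from a parent function and labels of the edges to the parents. -/
theorem existsSTreeOver_of_parent {V : Type} [Finite V] {root : V} {p : V → V} {d : V → ℕ}
    (hd : ∀ v, v ≠ root → d (p v) < d v) (lab : V → U) (hS : IsSepSystem S)
    (hlab : ∀ v, v ≠ root → lab v ∈ S)
    (hF : ∀ t, {x | (∃ v, v ≠ root ∧ p v = t ∧ lab v = x) ∨ (t ≠ root ∧ x = (lab t)⁻¹)} ∈ F) :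
    ExistsSTreeOver S F := by
  classical
  let L : V → V → U := fun v w => if v ≠ root ∧ p v = w then lab v else (lab w)⁻¹
  have hL1 : ∀ v w, v ≠ root → p v = w → L v w = lab v := fun v w h e => if_pos ⟨h, e⟩
  have hL2 : ∀ v w, w ≠ root → p w = v → L v w = (lab w)⁻¹ := fun v w h e =>
    if_neg fun h' => parent_asymm hd h e h'
  refine ⟨V, inferInstance, ⟨parentGraph root p d hd, parentGraph_isTree hd,
    fun e => L e.fst e.snd, ?_, ?_⟩, ?_⟩
  · rintro ⟨⟨v, w⟩, ⟨h, e⟩ | ⟨h, e⟩⟩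
    · exact (hL1 v w h e).symm ▸ hlab v h
    · exact (hL2 v w h e).symm ▸ hS _ (hlab w h)
  · rintro ⟨⟨v, w⟩, ⟨h, e⟩ | ⟨h, e⟩⟩
    · change L w v = (L v w)⁻¹
      rw [hL1 v w h e, hL2 w v h e]
    · change L w v = (L v w)⁻¹
      rw [hL1 w v h e, hL2 v w h e, inv_inv]
  · intro t
    convert hF t using 1
    ext x
    constructor
    · rintro ⟨⟨⟨v, w⟩, ⟨h, e⟩ | ⟨h, e⟩⟩, rfl, rfl⟩
      · exact Or.inl ⟨v, h, e, (hL1 v w h e).symm⟩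
      · exact Or.inr ⟨h, hL2 v w h e⟩
    · rintro (⟨v, h, e, rfl⟩ | ⟨h, rfl⟩)
      · exact ⟨⟨(v, t), Or.inl ⟨h, e⟩⟩, rfl, hL1 v t h e⟩
      · exact ⟨⟨(p t, t), Or.inr ⟨h, rfl⟩⟩, rfl, hL2 _ t h rfl⟩

/-- Derivability from the empty set by a derivation of height at most `n`. -/
def DerivesIn (F : Set (Set U)) : ℕ → U → Prop
  | 0, _ => False
  | n + 1, x => ∃ σ ∈ F, x⁻¹ ∈ σ ∧ ∀ y ∈ σ, y ≠ x⁻¹ → DerivesIn F n y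

theorem DerivesIn.succ {n : ℕ} {x : U} (h : DerivesIn F n x) : DerivesIn F (n + 1) x := by
  induction n generalizing x with
  | zero => exact h.elim
  | succ n ih =>
    obtain ⟨σ, hσ, hx, hy⟩ := h
    exact ⟨σ, hσ, hx, fun y h1 h2 => ih (hy y h1 h2)⟩

theorem DerivesIn.mono {m n : ℕ} (hmn : m ≤ n) {x : U} (h : DerivesIn F m x) :
    DerivesIn F n x := by
  induction hmn with
  | refl => exact h
  | step _ ih => exact ih.succ

theorem exists_derivesIn_uniform [Finite U] {A : Set U} (h : ∀ y ∈ A, ∃ n, DerivesIn F n y) :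
    ∃ n, ∀ y ∈ A, DerivesIn F n y := by
  choose f hf using h
  obtain ⟨N, hN⟩ := (Set.finite_range fun y : A => f y.1 y.2).bddAbove
  exact ⟨N, fun y hy => (hf y hy).mono (hN ⟨⟨y, hy⟩, rfl⟩)⟩

theorem Derives.exists_derivesIn [Finite U] {x : U} (h : Derives F ∅ x) :
    ∃ n, DerivesIn F n x := by
  induction h with
  | leaf hp => exact hp.elim
  | @node x σ hσ hx _ ih =>
    obtain ⟨n, hn⟩ := exists_derivesIn_uniform (A := {y | y ∈ σ ∧ y ≠ x⁻¹})
      fun y hy => ih y hy.1 hy.2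
    exact ⟨n + 1, σ, hσ, hx, fun y h1 h2 => hn y ⟨h1, h2⟩⟩

/-- The paths from the root in the tree that has `σ₀` at the root and `σ n x` at the nodes of
height `n + 1` with outgoing edge `x`, listed from the last edge to the first. -/
def IsPath (σ₀ : Set U) (σ : ℕ → U → Set U) (N : ℕ) : List U → Prop
  | [] => True
  | [y] => y ∈ σ₀
  | y :: x :: l => y ∈ σ (N - (x :: l).length) x ∧ y ≠ x⁻¹ ∧ IsPath σ₀ σ N (x :: l)

/-- The nodes are the paths of separations from the root. Bounding heights by a common `N` makes the
tree finite. -/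
theorem Refutes.existsSTreeOver [Finite U] (hS : IsSepSystem S) (hstar : ∀ σ ∈ F, IsStar S σ)
    (h : Refutes F ∅) : ExistsSTreeOver S F := by
  classical
  obtain ⟨σ₀, hσ₀, h₀⟩ := h
  -- The element `u` only serves as the default label at the root.
  rcases isEmpty_or_nonempty U with hU | ⟨⟨u⟩⟩
  · refine ⟨Unit, inferInstance, ⟨⊥, .of_subsingleton, fun e => e.adj.elim, fun e => e.adj.elim,
      fun e => e.adj.elim⟩, fun t => ?_⟩
    rwa [Subsingleton.elim (STree.nodeLabels _ t) σ₀]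
  obtain ⟨N, hN⟩ := exists_derivesIn_uniform (A := σ₀) fun y hy => (h₀ y hy).exists_derivesIn
  have hch : ∀ n x, ∃ τ : Set U, DerivesIn F (n + 1) x →
      τ ∈ F ∧ x⁻¹ ∈ τ ∧ ∀ y ∈ τ, y ≠ x⁻¹ → DerivesIn F n y := by
    intro n x
    by_cases hx : DerivesIn F (n + 1) x
    · obtain ⟨τ, h⟩ := hx
      exact ⟨τ, fun _ => h⟩
    · exact ⟨∅, fun h => (hx h).elim⟩
  choose σ hσ using hch
  have hpath : ∀ x l, IsPath σ₀ σ N (x :: l) → DerivesIn F (N - l.length) x ∧ x ∈ S := by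
    intro x l
    induction l generalizing x with
    | nil => exact fun h => ⟨hN x h, (hstar _ hσ₀).1 h⟩
    | cons y l ih =>
      rintro ⟨h1, h2, h3⟩
      have hy := (ih y h3).1
      obtain hz | ⟨k, hk⟩ : N - l.length = 0 ∨ ∃ k, N - l.length = k + 1 := by
        cases N - l.length <;> simp
      · rw [hz] at hy
        exact hy.elim
      · have e : N - (y :: l).length = k := by
          rw [List.length_cons]
          omega
        rw [hk] at hy
        rw [e] at h1 ⊢
        have h4 := hσ k y hy
        exact ⟨h4.2.2 x h1 h2, (hstar _ h4.1).1 h1⟩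
  -- Nothing is derivable at height 0, so no path outruns `N`.
  have hlen : ∀ l, IsPath σ₀ σ N l → l.length ≤ N := by
    rintro (_ | ⟨x, l⟩) hl
    · exact Nat.zero_le _
    · have := (hpath x l hl).1
      by_contra hgt
      rw [List.length_cons] at hgt
      rw [show N - l.length = 0 by omega] at this
      exact this
  have htail : ∀ l, IsPath σ₀ σ N l → IsPath σ₀ σ N l.tail := by
    rintro (_ | ⟨x, _ | ⟨y, l⟩⟩) hl
    exacts [trivial, trivial, hl.2.2]
  have hstarAt : ∀ x l, IsPath σ₀ σ N (x :: l) →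
      σ (N - (x :: l).length) x ∈ F ∧ x⁻¹ ∈ σ (N - (x :: l).length) x := by
    intro x l hl
    have h1 := hlen _ hl
    have h2 := (hpath x l hl).1
    rw [List.length_cons] at h1 ⊢
    rw [show N - l.length = N - (l.length + 1) + 1 by omega] at h2
    exact ⟨(hσ _ _ h2).1, (hσ _ _ h2).2.1⟩
  have : Finite {l : List U // IsPath σ₀ σ N l} :=
    ((List.finite_length_le U N).subset hlen).to_subtype
  -- Nodes are moved to `Fin n` because the node set must live in `Type`, whatever the universe of
  -- `U`.
  obtain ⟨n, ⟨e⟩⟩ := Finite.exists_equiv_fin {l : List U // IsPath σ₀ σ N l}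
  let root : {l : List U // IsPath σ₀ σ N l} := ⟨[], trivial⟩
  let par : {l : List U // IsPath σ₀ σ N l} → {l : List U // IsPath σ₀ σ N l} :=
    fun l => ⟨l.1.tail, htail _ l.2⟩
  have hne : ∀ v, v ≠ e root → ∃ x l, ∃ h : IsPath σ₀ σ N (x :: l), v = e ⟨x :: l, h⟩ := by
    intro v hv
    obtain ⟨⟨_ | ⟨x, l⟩, hl⟩, rfl⟩ := e.surjective v
    · exact (hv rfl).elim
    · exact ⟨x, l, hl, rfl⟩
  have hcons : ∀ x l (h : IsPath σ₀ σ N (x :: l)), e ⟨x :: l, h⟩ ≠ e root := by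
    intro x l h he
    exact List.cons_ne_nil x l (congrArg Subtype.val (e.injective he))
  have hpar : ∀ x l (h : IsPath σ₀ σ N (x :: l)) t,
      e (par (e.symm (e ⟨x :: l, h⟩))) = e t ↔ l = t.1 := by
    intro x l h t
    rw [e.symm_apply_apply, e.apply_eq_iff_eq, Subtype.ext_iff]
    rfl
  refine existsSTreeOver_of_parent (root := e root) (p := fun v => e (par (e.symm v)))
    (d := fun v => (e.symm v).1.length) ?_ (fun v => (e.symm v).1.headD u) hS ?_ ?_
  · intro v hv
    obtain ⟨x, l, hl, rfl⟩ := hne v hv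
    simp [par]
  · intro v hv
    obtain ⟨x, l, hl, rfl⟩ := hne v hv
    simpa using (hpath x l hl).2
  · intro v
    obtain ⟨⟨_ | ⟨x, l⟩, hl⟩, rfl⟩ := e.surjective v
    · convert hσ₀ using 1
      ext y
      constructor
      · rintro (⟨v, hv, hp, rfl⟩ | ⟨h, -⟩)
        · obtain ⟨x, l, hl', rfl⟩ := hne v hv
          obtain rfl : l = [] := (hpar x l hl' _).1 hp
          simpa [IsPath] using hl'
        · exact (h rfl).elim
      · intro hy
        exact Or.inl ⟨e ⟨[y], hy⟩, hcons _ _ _, (hpar y [] hy _).2 rfl, by simp⟩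
    · convert (hstarAt x l hl).1 using 1
      ext y
      constructor
      · rintro (⟨v, hv, hp, rfl⟩ | ⟨-, rfl⟩)
        · obtain ⟨y, l', hl', rfl⟩ := hne v hv
          obtain rfl : l' = x :: l := (hpar y l' hl' _).1 hp
          simpa using hl'.1
        · simpa using (hstarAt x l hl).2
      · intro hy
        by_cases hyx : y = x⁻¹
        · exact Or.inr ⟨hcons _ _ _, by simpa using hyx⟩
        · exact Or.inl ⟨e ⟨y :: x :: l, hy, hyx, hl⟩, hcons _ _ _, (hpar y (x :: l) _ _).2 rfl,
            by simp⟩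

end Trees

end TangleTree

theorem mainTheorem1 {U : Type*} [TangleTree.SepUniverse U] [Finite U]
    (S : Set U) (hS : TangleTree.IsSepSystem S)
    (F : Set (Set U)) (hstar : ∀ σ ∈ F, TangleTree.IsStar S σ)
    (hstd : TangleTree.IsStandard S F)
    (hsep : TangleTree.IsCriticallySeparable S F) :
    Xor (TangleTree.ExistsSTreeOver S F) (∃ O : Set U, TangleTree.IsTangle S F O) := by
  by_cases hO : ∃ O : Set U, TangleTree.IsTangle S F O
  · obtain ⟨O, h⟩ := hO
    exact Or.inr ⟨⟨O, h⟩, fun hT => TangleTree.not_isTangle_of_existsSTreeOver hT h⟩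
  · have hP : TangleTree.IsPartialOrientation S (∅ : Set U) :=
      ⟨Set.empty_subset _, fun _ h => h.elim, fun _ h => h.elim, fun _ h => h.elim⟩
    exact Or.inl ⟨(hP.refutes hS hstar hstd hsep hO).existsSTreeOver hS hstar, hO⟩
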